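/- Let $d\ge 1$ and $k\ge 0$ be integers and $\alpha>0$ a real number. Write $\langle A,B\rangle=\operatorname{Tr}(A^\top B)$ for real $d\times d$ matrices, and let $\Delta_d$ be the set of real symmetric positive semidefinite $d\times d$ matrices of trace $1$. For every $t\in\{1,\dots,k\}$ let $F_t=x_tx_t^\top$ with a nonzero vector $x_t\in\mathbb{R}^d$, and put $F=\sum_{t=1}^k F_t$. For a function $w:\Delta_d\to\mathbb{R}$, matrices $A_1,\dots,A_k$ are called actions of Follow-the-Regularized-Leader (FTRL) with regularizer $w$ and learning rate $\alpha$ if for every $t\in\{1,\dots,k\}$ $$A_t\in\operatorname*{arg\,min}_{A\in\Delta_d}\Big\{\alpha\sum_{s=1}^{t-1}\langle A,F_s\rangle+w(A)\Big\},$$ where the sum is empty for $t=1$. Let $\lambda_{\min}(F)$ denote the least eigenvalue of $F$, and let $A^{1/2}$ denote the positive semidefinite square root of $A$. Then the following two statements hold. (a) Entropy regularizer. If $A_1,\dots,A_k$ are FTRL actions with $w(A)=\langle A,\log A-I\rangle$ (with the convention $0\log 0=0$ on the eigenvalues of $A$), then $$\lambda_{\min}(F)\ \ge\ -\frac{\log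 d}{\alpha}+\frac1\alpha\sum_{t=1}^k\bigl[1-\exp(-\alpha\operatorname{Tr}(F_t))\bigr]\frac{\langle A_t,F_t\rangle}{\operatorname{Tr}(F_t)}.$$ (b) $\ell_{1/2}$-regularizer. If $A_1,\dots,A_k$ are FTRL actions with $w(A)=-2\operatorname{Tr}(A^{1/2})$, then $$\lambda_{\min}(F)\ \ge\ -\frac{2\sqrt d}{\alpha}+\sum_{t=1}^k\frac{\langle A_t,F_t\rangle}{1+\langle A_t^{1/2},\alpha F_t\rangle}.$$ -/

import Mathlib

open scoped Matrix

/-- The trace inner product `⟨A, B⟩ = Tr(Aᵀ B)` on real `d × d` matrices. -/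
def matInner {d : ℕ} (A B : Matrix (Fin d) (Fin d) ℝ) : ℝ :=
  (Aᵀ * B).trace

/-- The action set: symmetric positive semidefinite real matrices of trace one. -/
def matSimplex (d : ℕ) : Set (Matrix (Fin d) (Fin d) ℝ) :=
  {A | A.PosSemidef ∧ A.trace = 1}

/-- The principal square root of a symmetric positive semidefinite matrix, i.e. the square root
applied to its eigenvalues (continuous functional calculus). -/
noncomputable def matSqrt {d : ℕ} (A : Matrix (Fin d) (Fin d) ℝ) : Matrix (Fin d) (Fin d) ℝ :=
  cfc Real.sqrt A

/-- The matrix logarithm of a symmetric matrix, i.e. `log` applied to its eigenvalues.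
`Real.log 0 = 0`, so `⟨A, log A⟩` is `∑ λ log λ` with `0 log 0 = 0` also for singular `A ≥ 0`. -/
noncomputable def matLog {d : ℕ} (A : Matrix (Fin d) (Fin d) ℝ) : Matrix (Fin d) (Fin d) ℝ :=
  cfc Real.log A

/-- The entropy regularizer `w(A) = ⟨A, log A - I⟩`. -/
noncomputable def entropyReg {d : ℕ} (A : Matrix (Fin d) (Fin d) ℝ) : ℝ :=
  matInner A (matLog A - 1)

/-- The `ℓ_{1/2}` regularizer `w(A) = -2 Tr(A^{1/2})`. -/
noncomputable def lHalfReg {d : ℕ} (A : Matrix (Fin d) (Fin d) ℝ) : ℝ :=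
  -2 * (matSqrt A).trace

/-- `A` is a sequence of Follow-the-Regularized-Leader actions for the regularizer `w`, the
learning rate `α` and the losses `F`: in every round `t`, `A t` minimizes
`α ∑_{s < t} ⟨U, F s⟩ + w U` over the action set. In the first round the sum is empty. -/
def IsFTRL {d k : ℕ} (w : Matrix (Fin d) (Fin d) ℝ → ℝ) (α : ℝ)
    (F A : Fin k → Matrix (Fin d) (Fin d) ℝ) : Prop :=
  ∀ t : Fin k, A t ∈ matSimplex d ∧
    IsMinOn (fun U => α * ∑ s ∈ Finset.Iio t, matInner U (F s) + w U) (matSimplex d) (A t)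

/-- The least eigenvalue of a real symmetric matrix of size at least one: its real spectrum is
the (finite, nonempty) set of its eigenvalues. -/
noncomputable def lambdaMin {d : ℕ} (A : Matrix (Fin d) (Fin d) ℝ) : ℝ :=
  sInf (spectrum ℝ A)

/-! It suffices that round `t` raises the minimum over Δ_d of the regularized cumulative loss by at
least a gain δ_t (`entropyReg_step`, `lHalfReg_step`). The gains add up from min w, which is at
least -log d - 1, respectively -2√d (`add_sum_le_of_forall_step`). The sum is then tested on U =
vvᵀ, with v a unit eigenvector for λ_min(F), where w(U) is -1, respectively at most 0.

For the gain, the minimizer A is explicit and the excess of the objective at U is an exact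
divergence. In eigenbases of U and A it reads ∑ V_ij² D(l_i, m_j), where V is the orthogonal change
of basis, l and m are the eigenvalues, and D is a scalar divergence.

Entropy: let y, z be the coordinates of x in the two bases, T = |x|² and t = αT. Divergence plus new
loss minus gain is a sum over (i, j) of binary quadratic forms in V_ij and y_i z_j / T. A free
parameter b enters each form but cancels in the sum. Nonnegativity of each form is a discriminant
inequality in r = l/m, which a suitable b makes true (`exists_quadratic_entropy_coeff`).

ℓ_{1/2}: the divergence is a weighted squared distance between U^{1/2} and A^{1/2}. Cauchy–Schwarz
bounds how far U^{1/2}x can move from A^{1/2}x, and a one-variable quadratic minimization gives the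
gain. -/

/-! ### Scalar inequalities for the relative entropy -/

/-- A rational lower bound for the relative entropy function `r log r - r + 1`, touching it at
`1` and at `r₀`. -/
theorem rational_le_mul_log_sub_add_one {B C b r₀ : ℝ} (hB : 0 < B) (hC : 0 < C) (h0 : 0 < r₀)
    (h1 : r₀ < 1)
    (hval : (Real.log r₀ - 1 + 1 / r₀) * (r₀ * (B * r₀ + C)) = b ^ 2 * (r₀ - 1) ^ 2)
    (hder : (B * r₀ + C) ^ 2 = b ^ 2 * ((C + 2 * B) * r₀ + C)) {r : ℝ} (hr : 0 < r) :
    b ^ 2 * (r - 1) ^ 2 ≤ (r * Real.log r - r + 1) * (B * r + C) := by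
  set k : ℝ → ℝ := fun r =>
    Real.log r - 1 + 1 / r - b ^ 2 * ((r - 1) ^ 2 / (r * (B * r + C))) with hk
  set Q : ℝ → ℝ := fun r => (B * r + C) ^ 2 - b ^ 2 * ((C + 2 * B) * r + C) with hQ
  have hlin : ∀ r, 0 < r → 0 < B * r + C := fun r hr => by positivity
  have hkd : ∀ r, 0 < r → HasDerivAt k ((r - 1) / (r ^ 2 * (B * r + C) ^ 2) * Q r) r := by
    intro r hr
    have hne : r * (B * r + C) ≠ 0 := (mul_pos hr (hlin r hr)).ne'
    have hl := (hlin r hr).ne'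
    have e1 := (((Real.hasDerivAt_log hr.ne').sub_const 1).add
      ((hasDerivAt_const r (1 : ℝ)).div (hasDerivAt_id r) hr.ne'))
    have e2 := ((((hasDerivAt_id r).sub_const 1).pow 2).div
      ((hasDerivAt_id r).mul (((hasDerivAt_id r).const_mul B).add_const C)) hne).const_mul (b ^ 2)
    refine ((e1.sub e2).congr_deriv ?_)
    simp only [id, Pi.mul_apply, Pi.pow_apply, hQ]
    have hr' := hr.ne'
    field_simp
    push_cast
    ring
  have hk1 : k 1 = 0 := by simp [hk]
  have hk0 : k r₀ = 0 := by
    have hl := (hlin r₀ h0).ne'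
    have : Real.log r₀ - 1 + 1 / r₀ = b ^ 2 * ((r₀ - 1) ^ 2 / (r₀ * (B * r₀ + C))) := by
      rw [← mul_div_assoc, eq_div_iff (mul_ne_zero h0.ne' hl), hval]
    simp only [hk, this, sub_self]
  have hcont : ∀ D : Set ℝ, D ⊆ Set.Ioi 0 → ContinuousOn k D := fun D hD x hx =>
    (hkd x (hD hx)).continuousAt.continuousWithinAt
  -- `k` vanishes at `r₀` and at 1, so Rolle gives a critical point `m` in between. Together with
  -- `r₀` it exhausts the roots of the quadratic `Q`, which fixes the sign of `k'` everywhere.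
  obtain ⟨m, ⟨hm0, hm1⟩, hm⟩ := exists_deriv_eq_zero h1
    (hcont _ fun x hx => h0.trans_le hx.1) (hk0.trans hk1.symm)
  have hmp : 0 < m := h0.trans hm0
  have hQm : Q m = 0 := by
    rw [(hkd m hmp).deriv] at hm
    have hl := (hlin m hmp).ne'
    rcases mul_eq_zero.1 hm with h | h
    · rw [div_eq_zero_iff] at h
      rcases h with h | h
      · linarith
      · exact absurd h (by positivity)
    · exact h
  have hQ0 : Q r₀ = 0 := by simp only [hQ]; linarith
  have hfac : ∀ r, Q r = B ^ 2 * ((r - r₀) * (r - m)) := by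
    have hu : B ^ 2 * (r₀ + m) + (2 * B * C - b ^ 2 * (C + 2 * B)) = 0 := by
      have : (r₀ - m) * (B ^ 2 * (r₀ + m) + (2 * B * C - b ^ 2 * (C + 2 * B))) = 0 := by
        simp only [hQ] at hQm hQ0
        linear_combination hQ0 - hQm
      exact (mul_eq_zero.1 this).resolve_left (sub_ne_zero.2 hm0.ne)
    intro r
    simp only [hQ] at hQ0 ⊢
    linear_combination hQ0 + (r - r₀) * hu
  have hsign : ∀ x, 0 < x → deriv k x =
      B ^ 2 / (x ^ 2 * (B * x + C) ^ 2) * ((x - 1) * ((x - r₀) * (x - m))) := by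
    intro x hx
    rw [(hkd x hx).deriv, hfac]; ring
  have hcoef : ∀ x, 0 < x → 0 ≤ B ^ 2 / (x ^ 2 * (B * x + C) ^ 2) := fun x hx => by positivity
  have hdiff : ∀ D : Set ℝ, D ⊆ Set.Ioi 0 → DifferentiableOn ℝ k D := fun D hD x hx =>
    (hkd x (hD hx)).differentiableAt.differentiableWithinAt
  have hmono : ∀ D : Set ℝ, Convex ℝ D → D ⊆ Set.Ioi 0 →
      (∀ x ∈ interior D, 0 ≤ (x - 1) * ((x - r₀) * (x - m))) → MonotoneOn k D := by
    intro D hc hD h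
    refine monotoneOn_of_deriv_nonneg hc (hcont D hD)
      (hdiff _ (interior_subset.trans hD)) fun x hx => ?_
    have hx0 : 0 < x := hD (interior_subset hx)
    rw [hsign x hx0]
    exact mul_nonneg (hcoef x hx0) (h x hx)
  have hanti : ∀ D : Set ℝ, Convex ℝ D → D ⊆ Set.Ioi 0 →
      (∀ x ∈ interior D, (x - 1) * ((x - r₀) * (x - m)) ≤ 0) → AntitoneOn k D := by
    intro D hc hD h
    refine antitoneOn_of_deriv_nonpos hc (hcont D hD)
      (hdiff _ (interior_subset.trans hD)) fun x hx => ?_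
    have hx0 : 0 < x := hD (interior_subset hx)
    rw [hsign x hx0]
    exact mul_nonpos_of_nonneg_of_nonpos (hcoef x hx0) (h x hx)
  -- `k` falls, rises, falls, rises across `r₀ < m < 1`; its two local minima, at `r₀` and 1, have
  -- value 0.
  have hkr : 0 ≤ k r := by
    rcases le_total r r₀ with h | h
    · rw [← hk0]
      refine hanti (Set.Ioc 0 r₀) (convex_Ioc _ _) (fun x hx => hx.1) (fun x hx => ?_)
        ⟨hr, h⟩ ⟨h0, le_rfl⟩ h
      have := interior_subset hx
      have := this.2
      exact mul_nonpos_of_nonpos_of_nonneg (by linarith)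
        (mul_nonneg_of_nonpos_of_nonpos (by linarith) (by linarith))
    rcases le_total r m with h' | h'
    · rw [← hk0]
      refine hmono (Set.Icc r₀ m) (convex_Icc _ _) (fun x hx => h0.trans_le hx.1) (fun x hx => ?_)
        ⟨le_rfl, hm0.le⟩ ⟨h, h'⟩ h
      obtain ⟨h2, h3⟩ := interior_subset hx
      exact mul_nonneg_of_nonpos_of_nonpos (by linarith)
        (mul_nonpos_of_nonneg_of_nonpos (by linarith) (by linarith))
    rcases le_total r 1 with h'' | h''
    · rw [← hk1]
      refine hanti (Set.Icc m 1) (convex_Icc _ _) (fun x hx => hmp.trans_le hx.1) (fun x hx => ?_)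
        ⟨h', h''⟩ ⟨hm1.le, le_rfl⟩ h''
      obtain ⟨h2, h3⟩ := interior_subset hx
      exact mul_nonpos_of_nonpos_of_nonneg (by linarith)
        (mul_nonneg (by linarith) (by linarith))
    · rw [← hk1]
      refine hmono (Set.Ici 1) (convex_Ici _) (fun x hx => Set.mem_Ioi.2 (zero_lt_one.trans_le (Set.mem_Ici.1 hx)))
        (fun x hx => ?_)
        (Set.mem_Ici.2 le_rfl) h'' h''
      have h2 : 1 ≤ x := interior_subset hx
      exact mul_nonneg (by linarith) (mul_nonneg (by linarith) (by linarith))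
  have hl := hlin r hr
  have h2 : k r * (r * (B * r + C)) =
      (r * Real.log r - r + 1) * (B * r + C) - b ^ 2 * (r - 1) ^ 2 := by
    simp only [hk]
    field_simp
  have h3 : 0 ≤ k r * (r * (B * r + C)) := mul_nonneg hkr (by positivity)
  linarith

/-- Gives positivity of the slope t - 2b below. After clearing the denominator, (t - 2)eᵗ + t + 2
vanishes at 0 and increases, since e⁻ᵗ > 1 - t. -/
theorem two_lt_self_add_two_mul_div_exp_sub_one {t : ℝ} (ht : 0 < t) :
    2 < t + 2 * (t / (Real.exp t - 1)) := by
  have h1 : 0 < Real.exp t - 1 := by linarith [Real.add_one_lt_exp ht.ne']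
  set f : ℝ → ℝ := fun t => (t - 2) * Real.exp t + t + 2 with hf
  have hd : ∀ x, HasDerivAt f ((x - 1) * Real.exp x + 1) x := by
    intro x
    refine (((((hasDerivAt_id x).sub_const 2).mul (Real.hasDerivAt_exp x)).add
      (hasDerivAt_id x)).add_const 2).congr_deriv ?_
    simp only [id]
    ring
  have hm : StrictMonoOn f (Set.Ici 0) := by
    refine strictMonoOn_of_deriv_pos (convex_Ici _)
      (fun x _ => (hd x).continuousAt.continuousWithinAt) fun x hx => ?_
    rw [interior_Ici] at hx
    have hx : 0 < x := hx
    rw [(hd x).deriv]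
    have h2 := Real.add_one_lt_exp (neg_ne_zero.2 hx.ne')
    have h3 : Real.exp (-x) * Real.exp x = 1 := by rw [← Real.exp_add]; simp
    nlinarith [Real.exp_pos x]
  have h4 := hm (Set.mem_Ici.2 le_rfl) (Set.mem_Ici.2 ht.le) ht
  simp only [hf, Real.exp_zero] at h4
  have h5 : 2 * (Real.exp t - 1) < (t + 2 * (t / (Real.exp t - 1))) * (Real.exp t - 1) := by
    have : (t + 2 * (t / (Real.exp t - 1))) * (Real.exp t - 1) = t * (Real.exp t - 1) + 2 * t := by
      field_simp
    rw [this]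
    linarith
  exact lt_of_mul_lt_mul_right h5 h1.le

/-- The scalar objective r log r - r + tr is minimized at r₀ = e⁻ᵗ, so equality must hold there. A
form degenerate in the direction v = x at r₀ forces b(1 - r₀) = 1 - r₀ - t r₀, that is b = 1 - t/(eᵗ
- 1). -/
theorem exists_quadratic_entropy_coeff {t : ℝ} (ht : 0 < t) :
    ∃ b : ℝ, ∀ r, 0 < r → 0 < (t - 2 * b) * r + (2 * b - (1 - Real.exp (-t))) ∧
      b ^ 2 * (r - 1) ^ 2 ≤ (r * Real.log r - r + 1) *
        ((t - 2 * b) * r + (2 * b - (1 - Real.exp (-t)))) := by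
  have h1 : 0 < Real.exp t - 1 := by linarith [Real.add_one_lt_exp ht.ne']
  set b := 1 - t / (Real.exp t - 1) with hb
  set r₀ := Real.exp (-t) with hr₀
  have h0 : 0 < r₀ := Real.exp_pos _
  have hlt : r₀ < 1 := by rw [hr₀, Real.exp_lt_one_iff]; linarith
  have hinv : Real.exp t = 1 / r₀ := by rw [hr₀, Real.exp_neg]; simp
  have hlog : Real.log r₀ = -t := by rw [hr₀, Real.log_exp]
  have hs : 1 - r₀ ≠ 0 := by linarith
  have hbs : b * (1 - r₀) = 1 - r₀ - t * r₀ := by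
    rw [hb, hinv]
    have : 1 / r₀ - 1 = (1 - r₀) / r₀ := by field_simp
    rw [this]
    field_simp
  have hB : 0 < t - 2 * b := by
    have := two_lt_self_add_two_mul_div_exp_sub_one ht
    rw [hb]; linarith
  -- Equivalent to t < sinh t, because (1 + e⁻ᵗ)(eᵗ - 1) = 2 sinh t.
  have hC : 0 < 2 * b - (1 - r₀) := by
    have h2 := Real.self_lt_sinh_iff.2 ht
    rw [Real.sinh_eq, ← hr₀] at h2
    have h3 : 2 * (t / (Real.exp t - 1)) < 1 + r₀ := by
      rw [← mul_div_assoc, div_lt_iff₀ h1]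
      have : r₀ * Real.exp t = 1 := by rw [hinv]; field_simp
      nlinarith
    rw [hb]; linarith
  refine ⟨b, fun r hr => ⟨by positivity, ?_⟩⟩
  have hlin : (t - 2 * b) * r₀ + (2 * b - (1 - r₀)) = b * (1 - r₀) := by
    linear_combination hbs
  refine rational_le_mul_log_sub_add_one hB hC h0 hlt ?_ ?_ hr
  · rw [hlin, hlog]
    field_simp
    linear_combination (-b * (1 - r₀)) * hbs
  · rw [hlin]
    linear_combination (-2 * b ^ 2) * hlin

/-- This is log s < s - 1 at s = m/l. Strictness is what makes the entropy minimizer unique. -/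
theorem mul_log_sub_add_pos {l m : ℝ} (hl : 0 ≤ l) (hm : 0 < m) (hne : l ≠ m) :
    0 < l * (Real.log l - Real.log m) - l + m := by
  rcases hl.eq_or_lt with rfl | hl
  · simpa using hm
  · have h := Real.log_lt_sub_one_of_pos (div_pos hm hl)
      (fun h => hne ((div_eq_one_iff_eq hl.ne').1 h).symm)
    rw [Real.log_div hm.ne' hl.ne'] at h
    have h2 := mul_lt_mul_of_pos_left h hl
    have : l * (m / l - 1) = m - l := by field_simp
    linarith

theorem mul_log_sub_add_nonneg {l m : ℝ} (hl : 0 ≤ l) (hm : 0 < m) :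
    0 ≤ l * (Real.log l - Real.log m) - l + m := by
  by_cases h : l = m
  · simp [h]
  · exact (mul_log_sub_add_pos hl hm h).le

/-- For a loss `t > 0`, a quadratic form in `(v, x)` whose coefficients are relative entropies
is nonnegative. -/
theorem exists_entropy_quadratic_form_nonneg {t : ℝ} (ht : 0 < t) :
    ∃ b : ℝ, ∀ l m v x : ℝ, 0 ≤ l → 0 < m →
      0 ≤ v ^ 2 * (l * (Real.log l - Real.log m) - l + m) + 2 * (v * x) * (b * (l - m)) +
        x ^ 2 * ((t - 2 * b) * l + (2 * b - (1 - Real.exp (-t))) * m) := by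
  obtain ⟨b, hb⟩ := exists_quadratic_entropy_coeff ht
  refine ⟨b, fun l m v x hl hm => ?_⟩
  set B := t - 2 * b
  set C := 2 * b - (1 - Real.exp (-t))
  have key : ∀ l, 0 < l → 0 ≤ v ^ 2 * (l * (Real.log l - Real.log m) - l + m) +
      2 * (v * x) * (b * (l - m)) + x ^ 2 * (B * l + C * m) := by
    intro l hl
    obtain ⟨h1, h2⟩ := hb (l / m) (div_pos hl hm)
    rw [Real.log_div hl.ne' hm.ne'] at h2
    set h := l / m * (Real.log l - Real.log m) - l / m + 1
    set g := B * (l / m) + C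
    have e : v ^ 2 * (l * (Real.log l - Real.log m) - l + m) +
      2 * (v * x) * (b * (l - m)) + x ^ 2 * (B * l + C * m) =
      m * (v ^ 2 * h + 2 * (v * x) * (b * (l / m - 1)) + x ^ 2 * g) := by
      simp only [h, g]; field_simp
    rw [e]
    refine mul_nonneg hm.le (nonneg_of_mul_nonneg_left ?_ h1)
    nlinarith [sq_nonneg (v * (b * (l / m - 1)) + x * g), mul_le_mul_of_nonneg_left h2 (sq_nonneg v)]
  -- Singular U has l = 0; this case follows by continuity of l log l.
  rcases hl.eq_or_lt with rfl | hl
  · have hc : Continuous fun l : ℝ => v ^ 2 * (l * (Real.log l - Real.log m) - l + m) +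
        2 * (v * x) * (b * (l - m)) + x ^ 2 * (B * l + C * m) := by
      simp only [mul_sub]
      have := Real.continuous_mul_log
      fun_prop
    exact ge_of_tendsto (hc.continuousWithinAt (s := Set.Ioi 0) (x := 0))
      (eventually_nhdsWithin_of_forall fun l hl => key l hl)
  · exact key l hl

/-! ### Spectral decompositions and traces in two eigenbases -/

open Matrix in
/-- `A` is diagonalized by the orthogonal matrix `Q` with eigenvalues `l`, compatibly with the
continuous functional calculus. -/
structure IsSpectral {d : ℕ} (A Q : Matrix (Fin d) (Fin d) ℝ) (l : Fin d → ℝ) : Prop where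
  transpose_mul_self : Qᵀ * Q = 1
  cfc_eq : ∀ f : ℝ → ℝ, cfc f A = Q * diagonal (fun i => f (l i)) * Qᵀ
  eq : A = Q * diagonal l * Qᵀ

namespace IsSpectral

open Matrix

variable {d : ℕ} {A Q B R : Matrix (Fin d) (Fin d) ℝ} {l m : Fin d → ℝ}

theorem self_mul_transpose (h : IsSpectral A Q l) : Q * Qᵀ = 1 :=
  mul_eq_one_comm.1 h.transpose_mul_self

theorem exists_of_isHermitian (hA : A.IsHermitian) : ∃ Q l, IsSpectral A Q l := by
  have hU := hA.eigenvectorUnitary.2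
  rw [mem_unitaryGroup_iff'] at hU
  refine ⟨hA.eigenvectorUnitary, hA.eigenvalues, ?_, fun f => ?_, ?_⟩
  · simpa [star_eq_conjTranspose] using hU
  · rw [hA.cfc_eq, IsHermitian.cfc, Unitary.conjStarAlgAut_apply]
    simp [star_eq_conjTranspose, Function.comp_def]
  · conv_lhs => rw [hA.spectral_theorem, Unitary.conjStarAlgAut_apply]
    simp [star_eq_conjTranspose]

theorem isHermitian (h : IsSpectral A Q l) : A.IsHermitian := by
  rw [h.eq, IsHermitian]
  simp [Matrix.mul_assoc]

theorem cfc (h : IsSpectral A Q l) (f : ℝ → ℝ) :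
    IsSpectral (cfc f A) Q fun i => f (l i) := by
  refine ⟨h.transpose_mul_self, fun g => ?_, h.cfc_eq f⟩
  rw [← cfc_comp' g f A ((finite_real_spectrum.image f).continuousOn _)
    (finite_real_spectrum.continuousOn _) h.isHermitian.isSelfAdjoint]
  exact h.cfc_eq _

theorem trace (h : IsSpectral A Q l) : A.trace = ∑ i, l i := by
  rw [h.eq, trace_mul_comm, ← Matrix.mul_assoc, h.transpose_mul_self, Matrix.one_mul,
    trace_diagonal]

theorem nonneg (h : IsSpectral A Q l) (hA : A.PosSemidef) (i : Fin d) : 0 ≤ l i := by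
  have h1 := hA.conjTranspose_mul_mul_same Q
  have h2 : Qᴴ * A * Q = diagonal l := by
    rw [h.eq, conjTranspose_eq_transpose_of_trivial]
    calc Qᵀ * (Q * diagonal l * Qᵀ) * Q = (Qᵀ * Q) * diagonal l * (Qᵀ * Q) := by
          simp only [Matrix.mul_assoc]
      _ = diagonal l := by rw [h.transpose_mul_self]; simp
  rw [h2, posSemidef_diagonal_iff] at h1
  exact h1 i

theorem posSemidef (h : IsSpectral A Q l) (hl : ∀ i, 0 ≤ l i) : A.PosSemidef := by
  have := (posSemidef_diagonal_iff.2 hl).mul_mul_conjTranspose_same Q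
  rwa [conjTranspose_eq_transpose_of_trivial, ← h.eq] at this

theorem mem_matSimplex (h : IsSpectral A Q l) (hl : ∀ i, 0 ≤ l i) (h1 : ∑ i, l i = 1) :
    A ∈ matSimplex d :=
  ⟨h.posSemidef hl, h.trace.trans h1⟩

theorem matInner_eq (h : IsSpectral A Q l) (h' : IsSpectral B R m) :
    matInner A B = ∑ i, ∑ j, (Qᵀ * R) i j ^ 2 * (l i * m j) := by
  have h1 : matInner A B = ((diagonal l * (Qᵀ * R)) * (diagonal m * (Qᵀ * R)ᵀ)).trace := by
    have hs : Aᵀ = A := by simpa using h.isHermitian.eq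
    rw [matInner, hs, h.eq, h'.eq, Matrix.mul_assoc Q, Matrix.mul_assoc Q, trace_mul_comm]
    simp only [Matrix.mul_assoc, transpose_mul, transpose_transpose]
  rw [h1, Matrix.trace]
  refine Finset.sum_congr rfl fun i _ => ?_
  rw [diag_apply, mul_apply]
  refine Finset.sum_congr rfl fun j _ => ?_
  rw [diagonal_mul, diagonal_mul, transpose_apply]
  ring

theorem sum_sq_right (h : IsSpectral A Q l) (h' : IsSpectral B R m) (i : Fin d) :
    ∑ j, (Qᵀ * R) i j ^ 2 = 1 := by
  have : (Qᵀ * R) * (Qᵀ * R)ᵀ = 1 := by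
    rw [transpose_mul, transpose_transpose, Matrix.mul_assoc, ← Matrix.mul_assoc R,
      h'.self_mul_transpose, Matrix.one_mul, h.transpose_mul_self]
  have := congr_fun (congr_fun this i) i
  rw [mul_apply, one_apply_eq] at this
  simpa only [transpose_apply (Qᵀ * R), sq] using this

theorem sum_sq_left (h : IsSpectral A Q l) (h' : IsSpectral B R m) (j : Fin d) :
    ∑ i, (Qᵀ * R) i j ^ 2 = 1 := by
  have h1 := h'.sum_sq_right h j
  rw [← h1]
  refine Finset.sum_congr rfl fun i _ => ?_
  rw [← transpose_apply (Qᵀ * R), transpose_mul, transpose_transpose]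

theorem matInner_vecMulVec (h : IsSpectral A Q l) (x : Fin d → ℝ) :
    matInner A (vecMulVec x x) = ∑ i, l i * (Qᵀ *ᵥ x) i ^ 2 := by
  have hs : Aᵀ = A := by simpa using h.isHermitian.eq
  rw [matInner, hs, mul_vecMulVec, trace_vecMulVec, dotProduct_comm, h.eq,
    Matrix.mul_assoc, ← mulVec_mulVec, ← mulVec_mulVec, dotProduct_mulVec, ← mulVec_transpose,
    dotProduct]
  refine Finset.sum_congr rfl fun i _ => ?_
  rw [mulVec_diagonal]
  ring

theorem sum_mulVec_sq (h : IsSpectral A Q l) (x : Fin d → ℝ) :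
    ∑ i, (Qᵀ *ᵥ x) i ^ 2 = x ⬝ᵥ x := by
  have : (Qᵀ *ᵥ x) ⬝ᵥ (Qᵀ *ᵥ x) = x ⬝ᵥ x := by
    rw [dotProduct_mulVec, vecMul_transpose, mulVec_mulVec, h.self_mul_transpose, one_mulVec]
  rw [← this, dotProduct]
  exact Finset.sum_congr rfl fun i _ => sq _

theorem entropyReg_eq (h : IsSpectral A Q l) :
    entropyReg A = ∑ i, (l i * Real.log (l i) - l i) := by
  have hs : Aᵀ = A := by simpa using h.isHermitian.eq
  have h1 : A * matLog A = Q * diagonal (fun i => l i * Real.log (l i)) * Qᵀ := by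
    rw [matLog, h.cfc_eq]
    nth_rw 1 [h.eq]
    calc Q * diagonal l * Qᵀ * (Q * diagonal (fun i => Real.log (l i)) * Qᵀ)
        = Q * diagonal l * (Qᵀ * Q) * diagonal (fun i => Real.log (l i)) * Qᵀ := by
          simp only [Matrix.mul_assoc]
      _ = _ := by
          rw [h.transpose_mul_self, Matrix.mul_one, Matrix.mul_assoc Q, diagonal_mul_diagonal]
  rw [entropyReg, matInner, hs, Matrix.mul_sub, Matrix.mul_one, trace_sub, h.trace, h1,
    trace_mul_comm, ← Matrix.mul_assoc, h.transpose_mul_self, Matrix.one_mul, trace_diagonal,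
    Finset.sum_sub_distrib]

theorem lHalfReg_eq (h : IsSpectral A Q l) : lHalfReg A = -2 * ∑ i, Real.sqrt (l i) := by
  rw [lHalfReg, matSqrt, (h.cfc Real.sqrt).trace]

end IsSpectral

/-! ### Telescoping, the test projection and bounds on the regularizers -/

section FTRL

open Matrix

variable {d k : ℕ}

theorem matInner_smul_right (c : ℝ) (A B : Matrix (Fin d) (Fin d) ℝ) :
    matInner A (c • B) = c * matInner A B := by
  simp [matInner]

theorem matInner_add_right (A B C : Matrix (Fin d) (Fin d) ℝ) :
    matInner A (B + C) = matInner A B + matInner A C := by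
  simp [matInner, Matrix.mul_add]

theorem matInner_sum_right {ι : Type*} (A : Matrix (Fin d) (Fin d) ℝ) (s : Finset ι)
    (F : ι → Matrix (Fin d) (Fin d) ℝ) :
    matInner A (∑ i ∈ s, F i) = ∑ i ∈ s, matInner A (F i) := by
  simp [matInner, Matrix.mul_sum, trace_sum]

/-- The per-round gains of a Follow-the-Regularized-Leader sequence add up. -/
theorem add_sum_le_of_forall_step {w : Matrix (Fin d) (Fin d) ℝ → ℝ} {α m₀ : ℝ}
    {F A : Fin k → Matrix (Fin d) (Fin d) ℝ} {δ : Fin k → ℝ}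
    (hA : ∀ t, A t ∈ matSimplex d) (hm : ∀ U ∈ matSimplex d, m₀ ≤ w U)
    (hstep : ∀ t, ∀ U ∈ matSimplex d,
      matInner (A t) (α • ∑ s ∈ Finset.Iio t, F s) + w (A t) + δ t ≤
        matInner U (α • ∑ s ∈ Finset.Iio t, F s) + w U + matInner U (α • F t))
    {U : Matrix (Fin d) (Fin d) ℝ} (hU : U ∈ matSimplex d) :
    m₀ + ∑ t, δ t ≤ α * matInner U (∑ t, F t) + w U := by
  have key : ∀ n, n ≤ k → ∀ U ∈ matSimplex d,
      m₀ + ∑ t : Fin k with t.1 < n, δ t ≤ matInner U (α • ∑ t : Fin k with t.1 < n, F t) + w U := by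
    intro n
    induction n with
    | zero =>
      intro _ U hU
      simpa [matInner] using hm U hU
    | succ n ih =>
      intro hn U hU
      set t : Fin k := ⟨n, hn⟩ with ht
      have h1 : (Finset.univ.filter fun s : Fin k => s.1 < n) = Finset.Iio t := by
        ext s; simp [ht, Fin.lt_def]
      have h2 : (Finset.univ.filter fun s : Fin k => s.1 < n + 1) =
          insert t (Finset.Iio t) := by
        ext s; simp only [ht, Finset.mem_filter, Finset.mem_univ, true_and, Finset.mem_insert,
          Finset.mem_Iio, Fin.lt_def, Fin.ext_iff]; omega
      -- The bound for the earlier rounds is used at the action `A t`, and `hstep` carries it over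
      -- to an arbitrary `U`.
      have h3 := ih (by omega) (A t) (hA t)
      rw [h1] at h3
      rw [h2, Finset.sum_insert (by simp), Finset.sum_insert (by simp), smul_add,
        matInner_add_right]
      linarith [hstep t U hU]
  have := key k le_rfl U hU
  simpa [matInner_smul_right] using this

theorem exists_lambdaMin_projection (hd : 1 ≤ d) {F : Matrix (Fin d) (Fin d) ℝ}
    (hF : F.IsHermitian) :
    ∃ U ∈ matSimplex d, U * U = U ∧ matInner U F = lambdaMin F := by
  have : Nonempty (Fin d) := ⟨⟨0, hd⟩⟩
  have hmem : lambdaMin F ∈ Set.range hF.eigenvalues := by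
    rw [← hF.spectrum_real_eq_range_eigenvalues]
    refine Set.Nonempty.csInf_mem ?_ finite_real_spectrum
    rw [hF.spectrum_real_eq_range_eigenvalues]
    exact Set.range_nonempty _
  obtain ⟨i, hi⟩ := hmem
  set v : Fin d → ℝ := (hF.eigenvectorBasis i).ofLp with hv
  have hFv : F *ᵥ v = lambdaMin F • v := by
    rw [← hi]; exact hF.mulVec_eigenvectorBasis i
  have hv1 : v ⬝ᵥ v = 1 := by
    have h := hF.eigenvectorBasis.orthonormal.1 i
    have h2 : ‖hF.eigenvectorBasis i‖ ^ 2 = 1 := by rw [h]; norm_num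
    rw [EuclideanSpace.norm_sq_eq] at h2
    rw [dotProduct, ← h2]
    refine Finset.sum_congr rfl fun j _ => ?_
    rw [Real.norm_eq_abs, sq_abs, sq]
  refine ⟨vecMulVec v v, ⟨?_, ?_⟩, ?_, ?_⟩
  · simpa using posSemidef_vecMulVec_self_star v
  · rw [trace_vecMulVec, hv1]
  · rw [vecMulVec_mul_vecMulVec, hv1]; simp
  · rw [matInner, transpose_vecMulVec, vecMulVec_mul, trace_vecMulVec, dotProduct_comm,
      ← dotProduct_mulVec, hFv, dotProduct_smul, hv1]
    simp

theorem spectrum_subset_of_mul_self {U : Matrix (Fin d) (Fin d) ℝ} (h : U * U = U) :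
    spectrum ℝ U ⊆ {0, 1} :=
  IsIdempotentElem.spectrum_subset ℝ h

/-- A projection has spectrum in {0, 1}, where `Real.log` vanishes, so only -Tr U = -1 remains. -/
theorem entropyReg_of_mul_self {U : Matrix (Fin d) (Fin d) ℝ} (hU : U ∈ matSimplex d)
    (h : U * U = U) : entropyReg U = -1 := by
  have h0 : matLog U = 0 := by
    rw [matLog, cfc_congr (g := fun _ => 0), cfc_const_zero]
    intro x hx
    rcases spectrum_subset_of_mul_self h hx with rfl | rfl <;> simp
  rw [entropyReg, h0, matInner]
  simp [hU.2]

theorem lHalfReg_nonpos {U : Matrix (Fin d) (Fin d) ℝ} (hU : U ∈ matSimplex d) :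
    lHalfReg U ≤ 0 := by
  obtain ⟨Q, l, h⟩ := IsSpectral.exists_of_isHermitian hU.1.1
  rw [h.lHalfReg_eq]
  have := Finset.sum_nonneg fun i (_ : i ∈ Finset.univ) => Real.sqrt_nonneg (l i)
  linarith

/-- Nonnegativity of the relative entropy with respect to I/d. -/
theorem neg_log_sub_one_le_entropyReg (hd : 1 ≤ d) {U : Matrix (Fin d) (Fin d) ℝ}
    (hU : U ∈ matSimplex d) : -Real.log d - 1 ≤ entropyReg U := by
  obtain ⟨Q, l, h⟩ := IsSpectral.exists_of_isHermitian hU.1.1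
  have hd0 : (0 : ℝ) < d := by exact_mod_cast hd
  have h1 : ∑ i, l i = 1 := h.trace.symm.trans hU.2
  have h2 : 0 ≤ ∑ i, (l i * (Real.log (l i) - Real.log (d : ℝ)⁻¹) - l i + (d : ℝ)⁻¹) :=
    Finset.sum_nonneg fun i _ => mul_log_sub_add_nonneg (h.nonneg hU.1 i) (inv_pos.2 hd0)
  have h3 : ∑ i, (l i * (Real.log (l i) - Real.log (d : ℝ)⁻¹) - l i + (d : ℝ)⁻¹) =
      ∑ i, (l i * Real.log (l i) - l i) + (∑ i, l i) * Real.log d + 1 := by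
    simp only [Finset.sum_add_distrib, Finset.sum_sub_distrib, mul_sub, Real.log_inv,
      Finset.sum_mul]
    simp [hd0.ne']
    ring
  rw [h.entropyReg_eq]
  rw [h3, h1] at h2
  linarith

theorem neg_two_mul_sqrt_le_lHalfReg {U : Matrix (Fin d) (Fin d) ℝ}
    (hU : U ∈ matSimplex d) : -(2 * Real.sqrt d) ≤ lHalfReg U := by
  obtain ⟨Q, l, h⟩ := IsSpectral.exists_of_isHermitian hU.1.1
  have h1 : ∑ i, l i = 1 := h.trace.symm.trans hU.2
  have h2 : (∑ i, Real.sqrt (l i)) ^ 2 ≤ d := by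
    have := sq_sum_le_card_mul_sum_sq (s := Finset.univ) (f := fun i => Real.sqrt (l i))
    simp only [Real.sq_sqrt (h.nonneg hU.1 _), h1] at this
    simpa using this
  rw [h.lHalfReg_eq]
  linarith [Real.le_sqrt_of_sq_le h2]

end FTRL

/-! ### The gain of a single round -/

section Step

open Matrix

variable {d : ℕ} {A Q B R G U : Matrix (Fin d) (Fin d) ℝ} {l m : Fin d → ℝ}

theorem eq_zero_of_sum_sum_nonpos {ι κ : Type*} [Fintype ι] [Fintype κ] {f : ι → κ → ℝ}
    (hf : ∀ i j, 0 ≤ f i j) (hs : ∑ i, ∑ j, f i j ≤ 0) (i : ι) (j : κ) : f i j = 0 := by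
  have h1 : 0 ≤ ∑ i, ∑ j, f i j := Finset.sum_nonneg fun i _ => Finset.sum_nonneg fun j _ => hf i j
  have h2 := (Finset.sum_eq_zero_iff_of_nonneg
    fun i _ => Finset.sum_nonneg fun j _ => hf i j).1 (hs.antisymm h1) i (Finset.mem_univ i)
  exact (Finset.sum_eq_zero_iff_of_nonneg fun j _ => hf i j).1 h2 j (Finset.mem_univ j)

/-- Turns a vanishing divergence into equality of matrices: the hypothesis says that QᵀR intertwines
the two diagonal matrices. -/
theorem IsSpectral.eq_of_forall_eq_zero_or_eq (h : IsSpectral A Q l) (h' : IsSpectral B R m)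
    (hz : ∀ i j, (Qᵀ * R) i j = 0 ∨ l i = m j) : A = B := by
  have h1 : diagonal l * (Qᵀ * R) = (Qᵀ * R) * diagonal m := by
    ext i j
    rw [diagonal_mul, mul_diagonal]
    rcases hz i j with h | h <;> rw [h] <;> ring
  calc A = Q * (diagonal l * (Qᵀ * R)) * Rᵀ := by
        conv_lhs => rw [h.eq]
        simp only [Matrix.mul_assoc, h'.self_mul_transpose, Matrix.mul_one]
    _ = (Q * Qᵀ) * R * diagonal m * Rᵀ := by rw [h1]; simp only [Matrix.mul_assoc]
    _ = B := by rw [h.self_mul_transpose, Matrix.one_mul, ← h'.eq]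

theorem IsSpectral.matInner_self_cfc (h : IsSpectral A Q l) (f : ℝ → ℝ) :
    matInner (_root_.cfc f A) A = ∑ j, f (l j) * l j := by
  rw [(h.cfc f).matInner_eq h, h.transpose_mul_self]
  refine Finset.sum_congr rfl fun i _ => ?_
  rw [Finset.sum_eq_single i]
  · simp
  · intro j _ hj
    simp [one_apply_ne hj.symm]
  · simp

theorem IsSpectral.mulVec_eq (h' : IsSpectral B R m) (x : Fin d → ℝ) (i : Fin d) :
    (Qᵀ *ᵥ x) i = ∑ j, (Qᵀ * R) i j * (Rᵀ *ᵥ x) j := by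
  have : Qᵀ *ᵥ x = (Qᵀ * R) *ᵥ (Rᵀ *ᵥ x) := by
    rw [mulVec_mulVec, Matrix.mul_assoc, h'.self_mul_transpose, Matrix.mul_one]
  rw [this]
  rfl

/-- The Gibbs state `exp (-G) / Tr exp (-G)`; the excess of the entropy-regularized objective
over its value there is the relative entropy. -/
theorem exists_gibbs_state (hd : 1 ≤ d) (hG : G.IsHermitian) :
    ∃ A R m, IsSpectral A R m ∧ (∀ j, 0 < m j) ∧ A ∈ matSimplex d ∧
      ∀ U ∈ matSimplex d, ∀ Q l, IsSpectral U Q l →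
        matInner U G + entropyReg U = matInner A G + entropyReg A +
          ∑ i, ∑ j, (Qᵀ * R) i j ^ 2 * (l i * (Real.log (l i) - Real.log (m j)) - l i + m j) := by
  obtain ⟨R, g, hR⟩ := IsSpectral.exists_of_isHermitian hG
  have : Nonempty (Fin d) := ⟨⟨0, hd⟩⟩
  set Z := ∑ j, Real.exp (-g j) with hZ
  have hZ0 : 0 < Z := Finset.sum_pos (fun j _ => Real.exp_pos _) Finset.univ_nonempty
  set φ : ℝ → ℝ := fun t => Real.exp (-t) / Z with hφ
  have hm : IsSpectral (cfc φ G) R fun j => φ (g j) := hR.cfc φ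
  have hpos : ∀ j, 0 < φ (g j) := fun j => div_pos (Real.exp_pos _) hZ0
  have hsum : ∑ j, φ (g j) = 1 := by
    simp only [hφ, ← Finset.sum_div, ← hZ, div_self hZ0.ne']
  have hlog : ∀ j, Real.log (φ (g j)) = -g j - Real.log Z := fun j => by
    simp only [hφ]
    rw [Real.log_div (Real.exp_pos _).ne' hZ0.ne', Real.log_exp]
  refine ⟨cfc φ G, R, _, hm, hpos, hm.mem_matSimplex (fun j => (hpos j).le) hsum, ?_⟩
  intro U hU Q l h
  have h1 : ∑ i, l i = 1 := h.trace.symm.trans hU.2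
  have hA : matInner (cfc φ G) G + entropyReg (cfc φ G) = -Real.log Z - 1 := by
    rw [hR.matInner_self_cfc, hm.entropyReg_eq, ← Finset.sum_add_distrib]
    have : ∀ j, φ (g j) * g j + (φ (g j) * Real.log (φ (g j)) - φ (g j)) =
        φ (g j) * (-Real.log Z - 1) := fun j => by rw [hlog]; ring
    simp only [this, ← Finset.sum_mul, hsum, one_mul]
  have hi : ∀ f : Fin d → ℝ, ∑ i, f i = ∑ i, ∑ j, (Qᵀ * R) i j ^ 2 * f i := fun f => by
    refine Finset.sum_congr rfl fun i _ => ?_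
    rw [← Finset.sum_mul, h.sum_sq_right hm, one_mul]
  have hj : ∑ i, ∑ j, (Qᵀ * R) i j ^ 2 * φ (g j) = 1 := by
    rw [Finset.sum_comm, ← hsum]
    refine Finset.sum_congr rfl fun j _ => ?_
    rw [← Finset.sum_mul, h.sum_sq_left hm, one_mul]
  have h3 : ∑ i, ∑ j, (Qᵀ * R) i j ^ 2 * (l i * Real.log Z) = Real.log Z := by
    rw [← hi, ← Finset.sum_mul, h1, one_mul]
  have e : ∀ i j, (Qᵀ * R) i j ^ 2 *
      (l i * (Real.log (l i) - Real.log (φ (g j))) - l i + φ (g j)) =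
      (Qᵀ * R) i j ^ 2 * (l i * g j) + (Qᵀ * R) i j ^ 2 * (l i * Real.log (l i) - l i) +
      (Qᵀ * R) i j ^ 2 * (l i * Real.log Z) + (Qᵀ * R) i j ^ 2 * φ (g j) := fun i j => by
    rw [hlog]; ring
  rw [hA, h.matInner_eq hR, h.entropyReg_eq, hi fun i => l i * Real.log (l i) - l i]
  simp only [e, Finset.sum_add_distrib, h3, hj]
  ring

/-- The gain of one round of Follow-the-Regularized-Leader with the entropy regularizer. -/
theorem entropyReg_step (hd : 1 ≤ d) (hG : G.IsHermitian) (hA : A ∈ matSimplex d)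
    (hmin : IsMinOn (fun U => matInner U G + entropyReg U) (matSimplex d) A)
    {x : Fin d → ℝ} (hx : x ≠ 0) {α : ℝ} (hα : 0 < α) (hU : U ∈ matSimplex d) :
    matInner A G + entropyReg A + (1 - Real.exp (-α * (vecMulVec x x).trace)) *
        (matInner A (vecMulVec x x) / (vecMulVec x x).trace) ≤
      matInner U G + entropyReg U + matInner U (α • vecMulVec x x) := by
  obtain ⟨A', R, m, hR, hm, hA', hdiv⟩ := exists_gibbs_state hd hG
  -- Minimality makes the divergence of `A` from the Gibbs state nonpositive; its terms are
  -- nonnegative, so all vanish.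
  have hAA' : A = A' := by
    obtain ⟨Q, l, h⟩ := IsSpectral.exists_of_isHermitian hA.1.1
    refine h.eq_of_forall_eq_zero_or_eq hR fun i j => ?_
    have h1 : matInner A G + entropyReg A ≤ matInner A' G + entropyReg A' := hmin hA'
    rw [hdiv A hA Q l h] at h1
    have hnn : ∀ i j, 0 ≤ (Qᵀ * R) i j ^ 2 *
        (l i * (Real.log (l i) - Real.log (m j)) - l i + m j) := fun i j =>
      mul_nonneg (sq_nonneg _) (mul_log_sub_add_nonneg (h.nonneg hA.1 i) (hm j))
    have h5 : (Qᵀ * R) i j ^ 2 * (l i * (Real.log (l i) - Real.log (m j)) - l i + m j) = 0 :=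
      eq_zero_of_sum_sum_nonpos hnn (by linarith) i j
    rcases mul_eq_zero.1 h5 with h6 | h6
    · exact Or.inl (pow_eq_zero_iff two_ne_zero |>.1 h6)
    · by_contra! hne
      exact (mul_log_sub_add_pos (h.nonneg hA.1 i) (hm j) hne.2).ne' h6
  subst hAA'
  obtain ⟨Q, l, h⟩ := IsSpectral.exists_of_isHermitian hU.1.1
  set T := (vecMulVec x x).trace with hT
  have hTx : T = x ⬝ᵥ x := trace_vecMulVec x x
  have hT0 : 0 < T := by
    rw [hTx]
    simpa using dotProduct_self_star_pos_iff.2 hx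
  obtain ⟨b, hb⟩ := exists_entropy_quadratic_form_nonneg (mul_pos hα hT0)
  set V := Qᵀ * R with hV
  set y := Qᵀ *ᵥ x with hy
  set z := Rᵀ *ᵥ x with hz
  have hyy : ∑ i, y i ^ 2 = T := (h.sum_mulVec_sq x).trans hTx.symm
  have hzz : ∑ j, z j ^ 2 = T := (hR.sum_mulVec_sq x).trans hTx.symm
  have hyz : ∀ i, y i = ∑ j, V i j * z j := hR.mulVec_eq x
  have hzy : ∀ j, z j = ∑ i, V i j * y i := fun j => by
    rw [hz, h.mulVec_eq x j]
    refine Finset.sum_congr rfl fun i _ => ?_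
    rw [hV, ← transpose_apply (Qᵀ * R), transpose_mul, transpose_transpose]
  rw [hdiv U hU Q l h, matInner_smul_right, h.matInner_vecMulVec, hR.matInner_vecMulVec]
  -- The scalar form is taken at (V_ij, y_i z_j / T). Then ∑_j V_ij z_j = y_i and ∑_i V_ij y_i = z_j
  -- collapse the cross terms, and ∑ y_i² = ∑ z_j² = T collapses the squares.
  have hnn : 0 ≤ ∑ i, ∑ j, (V i j ^ 2 * (l i * (Real.log (l i) - Real.log (m j)) - l i + m j) +
      2 * (V i j * (y i * z j / T)) * (b * (l i - m j)) + (y i * z j / T) ^ 2 *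
        ((α * T - 2 * b) * l i + (2 * b - (1 - Real.exp (-(α * T)))) * m j)) :=
    Finset.sum_nonneg fun i _ => Finset.sum_nonneg fun j _ =>
      hb _ _ _ _ (h.nonneg hU.1 i) (hm j)
  have s1 : ∑ i, ∑ j, l i * y i * (V i j * z j) = ∑ i, l i * y i ^ 2 := by
    refine Finset.sum_congr rfl fun i _ => ?_
    rw [← Finset.mul_sum, ← hyz]; ring
  have s2 : ∑ i, ∑ j, m j * z j * (V i j * y i) = ∑ j, m j * z j ^ 2 := by
    rw [Finset.sum_comm]
    refine Finset.sum_congr rfl fun j _ => ?_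
    rw [← Finset.mul_sum, ← hzy]; ring
  have s3 : ∑ i, ∑ j, l i * y i ^ 2 * z j ^ 2 = (∑ i, l i * y i ^ 2) * T := by
    rw [← hzz, Finset.sum_mul_sum]
  have s4 : ∑ i, ∑ j, y i ^ 2 * (m j * z j ^ 2) = T * ∑ j, m j * z j ^ 2 := by
    rw [← hyy, Finset.sum_mul_sum]
  have e : ∀ i j, V i j ^ 2 * (l i * (Real.log (l i) - Real.log (m j)) - l i + m j) +
      2 * (V i j * (y i * z j / T)) * (b * (l i - m j)) + (y i * z j / T) ^ 2 *
        ((α * T - 2 * b) * l i + (2 * b - (1 - Real.exp (-(α * T)))) * m j) =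
      V i j ^ 2 * (l i * (Real.log (l i) - Real.log (m j)) - l i + m j) +
      2 * b / T * (l i * y i * (V i j * z j)) + (-(2 * b / T)) * (m j * z j * (V i j * y i)) +
      (α * T - 2 * b) / T ^ 2 * (l i * y i ^ 2 * z j ^ 2) +
      (2 * b - (1 - Real.exp (-(α * T)))) / T ^ 2 * (y i ^ 2 * (m j * z j ^ 2)) := fun i j => by
    ring
  have lin : ∀ (c : ℝ) (f : Fin d → Fin d → ℝ),
      ∑ i, ∑ j, c * f i j = c * ∑ i, ∑ j, f i j := fun c f => by simp only [Finset.mul_sum]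
  simp only [e, Finset.sum_add_distrib] at hnn
  rw [lin _ fun i j => l i * y i * (V i j * z j), lin _ fun i j => m j * z j * (V i j * y i),
    lin _ fun i j => l i * y i ^ 2 * z j ^ 2, lin _ fun i j => y i ^ 2 * (m j * z j ^ 2),
    s1, s2, s3, s4] at hnn
  set D := ∑ i, ∑ j, V i j ^ 2 * (l i * (Real.log (l i) - Real.log (m j)) - l i + m j)
  set P := ∑ i, l i * y i ^ 2
  set q := ∑ j, m j * z j ^ 2
  -- The contributions of `b` cancel, leaving divergence plus new loss minus gain.
  have e2 : D + 2 * b / T * P + -(2 * b / T) * q + (α * T - 2 * b) / T ^ 2 * (P * T) +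
      (2 * b - (1 - Real.exp (-(α * T)))) / T ^ 2 * (T * q) =
      D + α * P - (1 - Real.exp (-(α * T))) * (q / T) := by
    field_simp
    ring
  rw [e2] at hnn
  rw [neg_mul]
  linarith

/-- Normalizes the trace of (G + c)⁻². With g_i the least entry, the sum is at least 1 at c = 1 -
g_i because of the `i`-th term, and at most d · d⁻² ≤ 1 at c = d - g_i. -/
theorem exists_shift_sum_inv_sq_eq_one (hd : 1 ≤ d) (g : Fin d → ℝ) :
    ∃ c, (∀ j, 0 < g j + c) ∧ ∑ j, ((g j + c) ^ 2)⁻¹ = 1 := by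
  have : Nonempty (Fin d) := ⟨⟨0, hd⟩⟩
  obtain ⟨i, hi⟩ := Finite.exists_min g
  have hd1 : (1 : ℝ) ≤ d := by exact_mod_cast hd
  have hpos : ∀ c ∈ Set.Icc (1 - g i) (d - g i), ∀ j, 0 < g j + c := fun c hc j => by
    linarith [hi j, hc.1]
  have hcont : ContinuousOn (fun c => ∑ j, ((g j + c) ^ 2)⁻¹) (Set.Icc (1 - g i) (d - g i)) := by
    refine continuousOn_finsetSum _ fun j _ => ContinuousOn.inv₀ (by fun_prop) fun c hc => ?_
    exact pow_ne_zero 2 (hpos c hc j).ne'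
  obtain ⟨c, hc, h⟩ := intermediate_value_Icc' (by linarith) hcont (show (1 : ℝ) ∈ _ from by
    constructor
    · calc ∑ j, ((g j + (d - g i)) ^ 2)⁻¹ ≤ ∑ _j : Fin d, (d : ℝ)⁻¹ := by
            refine Finset.sum_le_sum fun j _ => inv_anti₀ (by linarith) ?_
            nlinarith [hi j]
        _ = 1 := by
            have : (d : ℝ) ≠ 0 := by linarith
            simp [this]
    · have h1 := Finset.single_le_sum (f := fun j => ((g j + (1 - g i)) ^ 2)⁻¹)
        (fun j _ => inv_nonneg.2 (sq_nonneg _)) (Finset.mem_univ i)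
      simpa using h1)
  exact ⟨c, hpos c hc, h⟩

/-- The minimizer `(G + c)⁻²` of the objective with the `ℓ_{1/2}` regularizer, together with the
divergence measuring the excess over its value. -/
theorem exists_lHalfReg_minimizer (hd : 1 ≤ d) (hG : G.IsHermitian) :
    ∃ (A R : Matrix (Fin d) (Fin d) ℝ) (p : Fin d → ℝ), (∀ j, 0 < p j) ∧ IsSpectral A R (fun j => ((p j) ^ 2)⁻¹) ∧
      IsSpectral (matSqrt A) R (fun j => (p j)⁻¹) ∧ A ∈ matSimplex d ∧
      ∀ U ∈ matSimplex d, ∀ Q l, IsSpectral U Q l →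
        matInner U G + lHalfReg U = matInner A G + lHalfReg A +
          ∑ i, ∑ j, (Qᵀ * R) i j ^ 2 * (p j * (Real.sqrt (l i) - (p j)⁻¹) ^ 2) := by
  obtain ⟨R, g, hR⟩ := IsSpectral.exists_of_isHermitian hG
  obtain ⟨c, hc, hsum⟩ := exists_shift_sum_inv_sq_eq_one hd g
  set φ : ℝ → ℝ := fun t => ((t + c) ^ 2)⁻¹ with hφ
  have hm : IsSpectral (cfc φ G) R fun j => ((g j + c) ^ 2)⁻¹ := hR.cfc φ
  have hsq : ∀ j, Real.sqrt ((g j + c) ^ 2)⁻¹ = (g j + c)⁻¹ := fun j => by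
    rw [Real.sqrt_inv, Real.sqrt_sq (hc j).le]
  have hs : IsSpectral (matSqrt (cfc φ G)) R fun j => (g j + c)⁻¹ := by
    have := hm.cfc Real.sqrt
    simp only [hsq] at this
    exact this
  refine ⟨cfc φ G, R, fun j => g j + c, hc, hm, hs,
    hm.mem_matSimplex (fun j => inv_nonneg.2 (sq_nonneg _)) hsum, fun U hU Q l h => ?_⟩
  have h1 : ∑ i, l i = 1 := h.trace.symm.trans hU.2
  have hA : matInner (cfc φ G) G + lHalfReg (cfc φ G) = -c - ∑ j, (g j + c)⁻¹ := by
    rw [hR.matInner_self_cfc, hm.lHalfReg_eq]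
    simp only [hsq, hφ]
    have : ∀ j, ((g j + c) ^ 2)⁻¹ * g j = (g j + c)⁻¹ - ((g j + c) ^ 2)⁻¹ * c := fun j => by
      have := (hc j).ne'
      field_simp
      ring
    simp only [this, Finset.sum_sub_distrib, ← Finset.sum_mul, hsum]
    ring
  have hi : ∀ f : Fin d → ℝ, ∑ i, f i = ∑ i, ∑ j, (Qᵀ * R) i j ^ 2 * f i := fun f => by
    refine Finset.sum_congr rfl fun i _ => ?_
    rw [← Finset.sum_mul, h.sum_sq_right hm, one_mul]
  have hj : ∑ j, (g j + c)⁻¹ = ∑ i, ∑ j, (Qᵀ * R) i j ^ 2 * (g j + c)⁻¹ := by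
    rw [Finset.sum_comm]
    refine Finset.sum_congr rfl fun j _ => ?_
    rw [← Finset.sum_mul, h.sum_sq_left hm, one_mul]
  have h3 : ∑ i, ∑ j, (Qᵀ * R) i j ^ 2 * (l i * c) = c := by
    rw [← hi, ← Finset.sum_mul, h1, one_mul]
  have e : ∀ i j, (Qᵀ * R) i j ^ 2 * ((g j + c) * (Real.sqrt (l i) - (g j + c)⁻¹) ^ 2) =
      (Qᵀ * R) i j ^ 2 * (l i * g j) + (Qᵀ * R) i j ^ 2 * (l i * c) +
      (-2) * ((Qᵀ * R) i j ^ 2 * Real.sqrt (l i)) + (Qᵀ * R) i j ^ 2 * (g j + c)⁻¹ :=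
    fun i j => by
      have h4 := (hc j).ne'
      have h5 := Real.sq_sqrt (h.nonneg hU.1 i)
      have h6 : (g j + c) * (Real.sqrt (l i) - (g j + c)⁻¹) ^ 2 =
          Real.sqrt (l i) ^ 2 * (g j + c) - 2 * Real.sqrt (l i) + (g j + c)⁻¹ := by
        field_simp
        ring
      rw [h6, h5]; ring
  rw [hA, h.matInner_eq hR, h.lHalfReg_eq, hi fun i => Real.sqrt (l i), hj]
  simp only [e, Finset.sum_add_distrib, ← Finset.mul_sum, h3]
  ring

/-- For κ > 0 the right side is at least n²/κ + α(n + u)², whose minimum over n is the left side.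
The product form of `hn` also covers κ = 0. -/
theorem div_one_add_mul_le_add_mul_sq {α κ K n u : ℝ} (hα : 0 < α) (hκ : 0 ≤ κ)
    (hK : 0 ≤ K) (hn : n ^ 2 ≤ K * κ) :
    α * u ^ 2 / (1 + α * κ) ≤ K + α * (n + u) ^ 2 := by
  have h0 : 0 ≤ α * κ := mul_nonneg hα.le hκ
  rw [div_le_iff₀ (by linarith)]
  set w := n + u with hw
  have hu : u = w - n := by rw [hw]; ring
  have h1 : -(2 * α * w * n) ≤ K + α ^ 2 * κ * w ^ 2 := by
    refine (neg_le_abs _).trans (abs_le_of_sq_le_sq ?_ (by positivity))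
    nlinarith [sq_nonneg (K - α ^ 2 * κ * w ^ 2),
      mul_le_mul_of_nonneg_left hn (sq_nonneg (2 * α * w))]
  rw [hu]
  nlinarith [mul_le_mul_of_nonneg_left hn hα.le]

/-- The gain of one round of Follow-the-Regularized-Leader with the `ℓ_{1/2}` regularizer. -/
theorem lHalfReg_step (hd : 1 ≤ d) (hG : G.IsHermitian) (hA : A ∈ matSimplex d)
    (hmin : IsMinOn (fun U => matInner U G + lHalfReg U) (matSimplex d) A)
    (x : Fin d → ℝ) {α : ℝ} (hα : 0 < α) (hU : U ∈ matSimplex d) :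
    matInner A G + lHalfReg A + α * (matInner A (vecMulVec x x) /
        (1 + matInner (matSqrt A) (α • vecMulVec x x))) ≤
      matInner U G + lHalfReg U + matInner U (α • vecMulVec x x) := by
  obtain ⟨A', R, p, hp, hR, hS, hA', hdiv⟩ := exists_lHalfReg_minimizer hd hG
  have hAA' : A = A' := by
    obtain ⟨Q, l, h⟩ := IsSpectral.exists_of_isHermitian hA.1.1
    refine h.eq_of_forall_eq_zero_or_eq hR fun i j => ?_
    have h1 : matInner A G + lHalfReg A ≤ matInner A' G + lHalfReg A' := hmin hA'
    rw [hdiv A hA Q l h] at h1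
    have hnn : ∀ i j, 0 ≤ (Qᵀ * R) i j ^ 2 * (p j * (Real.sqrt (l i) - (p j)⁻¹) ^ 2) :=
      fun i j => mul_nonneg (sq_nonneg _) (mul_nonneg (hp j).le (sq_nonneg _))
    have h5 : (Qᵀ * R) i j ^ 2 * (p j * (Real.sqrt (l i) - (p j)⁻¹) ^ 2) = 0 :=
      eq_zero_of_sum_sum_nonpos hnn (by linarith) i j
    rcases mul_eq_zero.1 h5 with h6 | h6
    · exact Or.inl (pow_eq_zero_iff two_ne_zero |>.1 h6)
    · right
      have h7 := (mul_eq_zero.1 h6).resolve_left (hp j).ne'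
      have h8 := sub_eq_zero.1 (pow_eq_zero_iff two_ne_zero |>.1 h7)
      rw [← Real.sq_sqrt (h.nonneg hA.1 i), h8, inv_pow]
  subst hAA'
  obtain ⟨Q, l, h⟩ := IsSpectral.exists_of_isHermitian hU.1.1
  rw [hdiv U hU Q l h, matInner_smul_right, matInner_smul_right, h.matInner_vecMulVec,
    hR.matInner_vecMulVec, hS.matInner_vecMulVec]
  set V := Qᵀ * R with hV
  set y := Qᵀ *ᵥ x with hy
  set z := Rᵀ *ᵥ x with hz
  set κ := ∑ j, (p j)⁻¹ * z j ^ 2 with hκ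
  have hyz : ∀ i, y i = ∑ j, V i j * z j := hR.mulVec_eq x
  have hκ0 : 0 ≤ κ := Finset.sum_nonneg fun j _ =>
    mul_nonneg (inv_nonneg.2 (hp j).le) (sq_nonneg _)
  -- `u` holds the coordinates of A^{1/2}x in the eigenbasis of `U`, so its squared norm is ⟨A,
  -- xxᵀ⟩.
  set u : Fin d → ℝ := fun i => ∑ j, V i j * ((p j)⁻¹ * z j) with hu
  have huu : ∑ i, u i ^ 2 = ∑ j, (p j ^ 2)⁻¹ * z j ^ 2 := by
    have h1 : V.transpose * V = 1 := by
      rw [hV, transpose_mul, transpose_transpose, Matrix.mul_assoc, ← Matrix.mul_assoc Q,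
        h.self_mul_transpose, Matrix.one_mul, hR.transpose_mul_self]
    have h2 : (V *ᵥ fun j => (p j)⁻¹ * z j) ⬝ᵥ (V *ᵥ fun j => (p j)⁻¹ * z j) =
        (fun j => (p j)⁻¹ * z j) ⬝ᵥ fun j => (p j)⁻¹ * z j := by
      rw [dotProduct_mulVec, ← mulVec_transpose, mulVec_mulVec, h1, one_mulVec]
    calc ∑ i, u i ^ 2 = (V *ᵥ fun j => (p j)⁻¹ * z j) ⬝ᵥ (V *ᵥ fun j => (p j)⁻¹ * z j) :=
          Finset.sum_congr rfl fun i _ => sq _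
      _ = _ := h2
      _ = _ := Finset.sum_congr rfl fun j _ => by ring
  have hrow : ∀ i, α * u i ^ 2 / (1 + α * κ) ≤
      ∑ j, V i j ^ 2 * (p j * (Real.sqrt (l i) - (p j)⁻¹) ^ 2) + α * (l i * y i ^ 2) := by
    intro i
    -- `N` is row `i` of U^{1/2} - A^{1/2}, written between the two eigenbases. Thus √l_i y_i = ∑
    -- N_j z_j + u_i, and Cauchy–Schwarz with weights p_j and 1/p_j bounds the first summand by the
    -- divergence of the row times κ.
    set N : Fin d → ℝ := fun j => V i j * (Real.sqrt (l i) - (p j)⁻¹) with hN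
    have h1 : l i * y i ^ 2 = (∑ j, N j * z j + u i) ^ 2 := by
      have : ∑ j, N j * z j + u i = Real.sqrt (l i) * y i := by
        rw [hyz, hu, ← Finset.sum_add_distrib, Finset.mul_sum]
        refine Finset.sum_congr rfl fun j _ => ?_
        simp only [hN]; ring
      rw [this, mul_pow, Real.sq_sqrt (h.nonneg hU.1 i)]
    have h2 : ∑ j, V i j ^ 2 * (p j * (Real.sqrt (l i) - (p j)⁻¹) ^ 2) = ∑ j, p j * N j ^ 2 :=
      Finset.sum_congr rfl fun j _ => by simp only [hN]; ring
    rw [h1, h2]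
    refine div_one_add_mul_le_add_mul_sq hα hκ0
      (Finset.sum_nonneg fun j _ => mul_nonneg (hp j).le (sq_nonneg _)) ?_
    refine Finset.sum_sq_le_sum_mul_sum_of_sq_le_mul _
      (fun j _ => mul_nonneg (hp j).le (sq_nonneg _))
      (fun j _ => mul_nonneg (inv_nonneg.2 (hp j).le) (sq_nonneg _)) fun j _ => ?_
    have := (hp j).ne'
    refine le_of_eq ?_
    field_simp
  have hall := Finset.sum_le_sum fun i (_ : i ∈ Finset.univ) => hrow i
  rw [Finset.sum_add_distrib, ← Finset.mul_sum, ← Finset.sum_div, ← Finset.mul_sum, huu,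
    mul_div_assoc] at hall
  linarith

end Step

/-! ### Assembly of the two bounds -/

theorem theorem3p5 (d k : ℕ) (hd : 1 ≤ d) (α : ℝ) (hα : 0 < α)
    (F : Fin k → Matrix (Fin d) (Fin d) ℝ)
    (hF : ∀ t, ∃ x : Fin d → ℝ, x ≠ 0 ∧ F t = Matrix.vecMulVec x x) :
    (∀ A : Fin k → Matrix (Fin d) (Fin d) ℝ, IsFTRL entropyReg α F A →
      lambdaMin (∑ t, F t) ≥
        -(Real.log d / α) + 1 / α * ∑ t,
          (1 - Real.exp (-α * (F t).trace)) * (matInner (A t) (F t) / (F t).trace)) ∧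
    (∀ A : Fin k → Matrix (Fin d) (Fin d) ℝ, IsFTRL lHalfReg α F A →
      lambdaMin (∑ t, F t) ≥
        -(2 * Real.sqrt d / α) + ∑ t,
          matInner (A t) (F t) / (1 + matInner (matSqrt (A t)) (α • F t))) := by
  have hherm : ∀ s : Finset (Fin k), (∑ t ∈ s, F t).IsHermitian := by
    intro s
    refine isSelfAdjoint_sum s fun t _ => ?_
    obtain ⟨x, -, hx⟩ := hF t
    rw [hx]
    simpa using (Matrix.posSemidef_vecMulVec_self_star x).1.isSelfAdjoint
  have hG : ∀ s : Finset (Fin k), (α • ∑ t ∈ s, F t).IsHermitian := fun s => by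
    have h := (hherm s).eq
    rw [Matrix.IsHermitian, Matrix.conjTranspose_smul, h, star_trivial]
  have hmin : ∀ {w : Matrix (Fin d) (Fin d) ℝ → ℝ} {A : Fin k → Matrix (Fin d) (Fin d) ℝ},
      IsFTRL w α F A → ∀ t, IsMinOn (fun U => matInner U (α • ∑ s ∈ Finset.Iio t, F s) + w U)
        (matSimplex d) (A t) := fun hA t => by
    simpa only [matInner_smul_right, matInner_sum_right] using (hA t).2
  obtain ⟨U, hU, hUU, hUF⟩ := exists_lambdaMin_projection hd (hherm Finset.univ)
  constructor
  · intro A hA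
    have h := add_sum_le_of_forall_step (w := entropyReg) (α := α) (F := F)
      (δ := fun t => (1 - Real.exp (-α * (F t).trace)) * (matInner (A t) (F t) / (F t).trace))
      (fun t => (hA t).1) (fun U hU => neg_log_sub_one_le_entropyReg hd hU) (fun t U hU => by
        obtain ⟨x, hx0, hx⟩ := hF t
        simp only [hx]
        exact entropyReg_step hd (hG _) (hA t).1 (hmin hA t) hx0 hα hU) hU
    -- The -1 of the test projection cancels the -1 in the lower bound -log d - 1.
    rw [hUF, entropyReg_of_mul_self hU hUU] at h
    rw [ge_iff_le, ← neg_div, one_div_mul_eq_div, ← add_div, div_le_iff₀ hα]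
    linarith
  · intro A hA
    have h := add_sum_le_of_forall_step (w := lHalfReg) (α := α) (F := F)
      (δ := fun t => α * (matInner (A t) (F t) / (1 + matInner (matSqrt (A t)) (α • F t))))
      (fun t => (hA t).1) (fun U hU => neg_two_mul_sqrt_le_lHalfReg hU) (fun t U hU => by
        obtain ⟨x, -, hx⟩ := hF t
        simp only [hx]
        exact lHalfReg_step hd (hG _) (hA t).1 (hmin hA t) x hα hU) hU
    rw [hUF, ← Finset.mul_sum] at h
    rw [ge_iff_le, ← neg_div, ← le_sub_iff_add_le, div_le_iff₀ hα]
    linarith [lHalfReg_nonpos hU]
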